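/- **Central convex unimodality.** A set $\mathcal B$ of probability distributions on $\mathbb R^m$ is *closed convex* if (i) $(1-\lambda)\nu_1+\lambda\nu_2\in\mathcal B$ for all $\nu_1,\nu_2\in\mathcal B$ and $\lambda\in(0,1)$, and (ii) $\nu\in\mathcal B$ whenever some sequence in $\mathcal B$ converges weakly to $\nu$. The *closed convex hull* of a set of distributions is the smallest closed convex set containing it. A *symmetric convex body* is a compact convex set $\mathcal K\subset\mathbb R^m$ with nonempty interior and $\mathcal K=-\mathcal K$. A distribution on $\mathbb R^m$ is *central convex unimodal* if it lies in the closed convex hull of the set of uniform distributions on symmetric convex bodies in $\mathbb R^m$. **Setting.** Let $K,L\ge 1$ be integers, $Q=2^K$, $F=2^K-1$, and $a>0$. The $Q$ treatment combinations are $q\in\{-1,+1\}^K$; the $F$ factorial effects $f$ are the nonempty subsets of $\{1,\dots,K\}$, and $g_{fq}=\prod_{k\in f}q_k$, $\boldsymbol b_q=(g_{fq})_f\in\mathbb R^F$. A finite population consists of $n$ units with potential outcomes $Y_i(q)\in\mathbb R$ and covariates $\boldsymbol x_i\in\mathbb R^L$, and group sizes $n_q\ge1$ with $\sum_q n_q=n$.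 Finite population (co)variances have divisor $n-1$; assume that the covariance matrix $\boldsymbol S_{\boldsymbol{xx}}$ of the covariates is invertible. Let $\boldsymbol S_{q,\boldsymbol x}$ be the row vector of covariances of $Y(q)$ with $\boldsymbol x$, and put $$Y_i^{\parallel}(q)=\bar Y(q)+\boldsymbol S_{q,\boldsymbol x}\boldsymbol S_{\boldsymbol{xx}}^{-1}(\boldsymbol x_i-\bar{\boldsymbol x}),\qquad Y_i^{\perp}(q)=Y_i(q)-Y_i^{\parallel}(q).$$ For $*\in\{\parallel,\perp\}$ let $\boldsymbol\tau_i^{*}=2^{-(K-1)}\sum_q\boldsymbol b_qY_i^{*}(q)$, let $S_{qq}^{*}$ be the variance of $Y^{*}(q)$ and $\boldsymbol S_{\boldsymbol{\tau\tau}}^{*}$ the covariance matrix of $\boldsymbol\tau^{*}$, and let $$\boldsymbol V^{*}=2^{-2(K-1)}\sum_q n_q^{-1}\,\boldsymbol b_q\boldsymbol b_q'\,S_{qq}^{*}-n^{-1}\boldsymbol S_{\boldsymbol{\tau\tau}}^{*}\in\mathbb R^{F\times F}.$$ For a positive semidefinite $\boldsymbol A\in\mathbb R^{F\times F}$, $\boldsymbol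 A^{1/2}$ is its positive semidefinite square root and, if $\operatorname{rank}\boldsymbol A\le p$, $\boldsymbol A^{1/2}_{p}$ is any matrix in $\mathbb R^{F\times p}$ with $\boldsymbol A^{1/2}_{p}(\boldsymbol A^{1/2}_{p})'=\boldsymbol A$. Let $\boldsymbol\varepsilon\sim\mathcal N(\boldsymbol 0,\boldsymbol I_F)$ and, independently of $\boldsymbol\varepsilon$, let $\boldsymbol\zeta_{LF,a}\sim\boldsymbol D\mid\boldsymbol D'\boldsymbol D\le a$, where $\boldsymbol D\sim\mathcal N(\boldsymbol 0,\boldsymbol I_{LF})$. **Proposition.** The following distributions are central convex unimodal: 1. the law of $\boldsymbol\varepsilon$ on $\mathbb R^F$; 2. the law of $\boldsymbol\zeta_{LF,a}$ on $\mathbb R^{LF}$; 3. for every such finite population, the law of $(\boldsymbol V^{\perp})^{1/2}\boldsymbol\varepsilon+(\boldsymbol V^{\parallel})^{1/2}_{LF}\,\boldsymbol\zeta_{LF,a}$ on $\mathbb R^F$, for every choice of $(\boldsymbol V^{\parallel})^{1/2}_{LF}$; 4. the limiting law after scaling by $\sqrt n$: if, along a sequence of such finite populations (with $K$, $L$ fixed),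 $n\boldsymbol V^{\perp}\to\boldsymbol W^{\perp}$ and $n\boldsymbol V^{\parallel}\to\boldsymbol W^{\parallel}$, then the law of $(\boldsymbol W^{\perp})^{1/2}\boldsymbol\varepsilon+(\boldsymbol W^{\parallel})^{1/2}_{LF}\,\boldsymbol\zeta_{LF,a}$, for every choice of $(\boldsymbol W^{\parallel})^{1/2}_{LF}$. In 3 and 4 the matrix roots are meaningful: $\boldsymbol V^{\perp},\boldsymbol V^{\parallel},\boldsymbol W^{\perp},\boldsymbol W^{\parallel}$ are positive semidefinite, and $\boldsymbol V^{\parallel},\boldsymbol W^{\parallel}$ have rank at most $LF$. -/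

import Mathlib

open MeasureTheory ProbabilityTheory Filter Topology
open scoped Matrix ENNReal BigOperators

noncomputable section

/-! ### Central convex unimodality -/

section CentralConvexUnimodal

/-- A set of distributions on `E` is closed convex if it is stable under two-point mixtures and
under limits of weakly convergent sequences. (The topology of `ProbabilityMeasure E` is that of
weak convergence.) -/
def IsClosedConvexSet {E : Type*} [TopologicalSpace E] [MeasurableSpace E] [OpensMeasurableSpace E]
    (B : Set (ProbabilityMeasure E)) : Prop :=
  (∀ ν₁ ∈ B, ∀ ν₂ ∈ B, ∀ t : ℝ, 0 < t → t < 1 → ∀ ν : ProbabilityMeasure E,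
      (ν : Measure E)
        = ENNReal.ofReal (1 - t) • (ν₁ : Measure E) + ENNReal.ofReal t • (ν₂ : Measure E) →
      ν ∈ B) ∧
  (∀ (u : ℕ → ProbabilityMeasure E) (ν : ProbabilityMeasure E),
      (∀ j, u j ∈ B) → Tendsto u atTop (𝓝 ν) → ν ∈ B)

/-- The closed convex hull of a set of distributions: the smallest closed convex set
containing it. -/
def distClosedConvexHull {E : Type*} [TopologicalSpace E] [MeasurableSpace E]
    [OpensMeasurableSpace E] (C : Set (ProbabilityMeasure E)) : Set (ProbabilityMeasure E) :=
  ⋂₀ {B | C ⊆ B ∧ IsClosedConvexSet B}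

/-- A symmetric convex body: a compact convex set with nonempty interior and `K = -K`. -/
def IsSymmConvexBody {ι : Type*} [Fintype ι] (K : Set (EuclideanSpace ℝ ι)) : Prop :=
  IsCompact K ∧ Convex ℝ K ∧ (interior K).Nonempty ∧ K = (fun v => -v) '' K

/-- The uniform distributions on symmetric convex bodies: Lebesgue measure conditioned on `K`. -/
def uniformSymmConvexBody (ι : Type*) [Fintype ι] :
    Set (ProbabilityMeasure (EuclideanSpace ℝ ι)) :=
  {ν | ∃ K, IsSymmConvexBody K ∧ (ν : Measure (EuclideanSpace ℝ ι)) = volume[|K]}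

/-- `μ` is a probability distribution that lies in the closed convex hull of the uniform
distributions on symmetric convex bodies. -/
def IsCentralConvexUnimodal {ι : Type*} [Fintype ι] (μ : Measure (EuclideanSpace ℝ ι)) : Prop :=
  ∃ ν ∈ distClosedConvexHull (uniformSymmConvexBody ι),
    (ν : Measure (EuclideanSpace ℝ ι)) = μ

end CentralConvexUnimodal

/-! ### The Gaussian laws -/

section Laws

/-- The law of `D` given `D'D ≤ a`, where `D` is a standard Gaussian vector. -/
def truncGaussian (ι : Type*) [Fintype ι] (a : ℝ) : Measure (EuclideanSpace ℝ ι) :=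
  (stdGaussian (EuclideanSpace ℝ ι))[|{d | d.ofLp ⬝ᵥ d.ofLp ≤ a}]

/-- The law of `B ε + A ζ`, where `ε` is a standard Gaussian vector, `ζ` is the Gaussian vector
truncated to `ζ'ζ ≤ a`, and `ε` and `ζ` are independent. -/
def gaussianPlusTruncLaw {ι κ : Type*} [Fintype ι] [Fintype κ]
    (B : Matrix ι ι ℝ) (A : Matrix ι κ ℝ) (a : ℝ) : Measure (EuclideanSpace ℝ ι) :=
  ((stdGaussian (EuclideanSpace ℝ ι)).prod (truncGaussian κ a)).map
    (fun p => WithLp.toLp 2 (B *ᵥ p.1.ofLp + A *ᵥ p.2.ofLp))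

end Laws

/-! ### Finite population of a `2^K` factorial experiment -/

/-- A treatment combination: a level `-1` or `+1` for each of the `K` factors. -/
abbrev Treatment (K : ℕ) : Type := Fin K → ℤˣ

/-- The factorial effects (main effects and interactions) correspond to the nonempty sets of
factors; there are `F = 2 ^ K - 1` of them. -/
abbrev FactorialEffect (K : ℕ) : Type := {S : Finset (Fin K) // S.Nonempty}

/-- Entry `g_{fq}` of the generating vector of the effect `f`: the product of the levels in `q`
of the factors in `f`. -/
def gen {K : ℕ} (f : FactorialEffect K) (q : Treatment K) : ℝ :=
  ∏ k ∈ f.1, ((q k : ℤ) : ℝ)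

/-- The finite population mean. -/
def popMean {n : ℕ} (u : Fin n → ℝ) : ℝ := (n : ℝ)⁻¹ * ∑ i, u i

/-- The finite population covariance, with divisor `n - 1`. -/
def popCov {n : ℕ} (u v : Fin n → ℝ) : ℝ :=
  ((n : ℝ) - 1)⁻¹ * ∑ i, (u i - popMean u) * (v i - popMean v)

/-- `n` units with potential outcomes `Y i q` under each treatment combination `q` and `L`
covariates `x i`, together with the (positive) sizes `size q` of the treatment groups. -/
structure FactorialPopulation (K L : ℕ) where
  n : ℕ
  Y : Fin n → Treatment K → ℝ
  x : Fin n → Fin L → ℝ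
  size : Treatment K → ℕ
  size_pos : ∀ q, 0 < size q
  sum_size : ∑ q, size q = n

namespace FactorialPopulation

variable {K L : ℕ} (P : FactorialPopulation K L)

/-- `S_xx`, the finite population covariance matrix of the covariates. -/
def Sxx : Matrix (Fin L) (Fin L) ℝ :=
  Matrix.of fun l l' => popCov (fun i => P.x i l) (fun i => P.x i l')

/-- `S_{q,x}`, the finite population covariances of the potential outcome `Y(q)` and the
covariates. -/
def Sqx (q : Treatment K) : Fin L → ℝ :=
  fun l => popCov (fun i => P.Y i q) (fun i => P.x i l)

/-- The finite population linear projection of `Y(q)` on the covariates,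
`Ȳ(q) + S_{q,x} S_xx⁻¹ (x_i - x̄)`. -/
def Ypar (i : Fin P.n) (q : Treatment K) : ℝ :=
  popMean (fun j => P.Y j q)
    + P.Sqx q ⬝ᵥ (P.Sxx⁻¹ *ᵥ fun l => P.x i l - popMean (fun j => P.x j l))

/-- The residual of the linear projection. -/
def Yperp (i : Fin P.n) (q : Treatment K) : ℝ := P.Y i q - P.Ypar i q

/-- The individual factorial effect `f` of unit `i` computed from an outcome table `y`,
`2^{-(K-1)} ∑_q g_{fq} y_i(q)`. -/
def indEffect (y : Fin P.n → Treatment K → ℝ) (f : FactorialEffect K) (i : Fin P.n) : ℝ :=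
  ((2 : ℝ) ^ (K - 1))⁻¹ * ∑ q, gen f q * y i q

/-- The sampling covariance of the factorial effect estimators computed from an outcome table
`y`: `2^{-2(K-1)} ∑_q n_q⁻¹ b_q b_q' S_qq - n⁻¹ S_ττ`. -/
def samplingCov (y : Fin P.n → Treatment K → ℝ) :
    Matrix (FactorialEffect K) (FactorialEffect K) ℝ :=
  Matrix.of fun f f' =>
    ((2 : ℝ) ^ (2 * (K - 1)))⁻¹ *
        ∑ q, (P.size q : ℝ)⁻¹ * (gen f q * gen f' q) * popCov (fun i => y i q) (fun i => y i q)
      - (P.n : ℝ)⁻¹ * popCov (P.indEffect y f) (P.indEffect y f')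

/-- The part of the sampling covariance explained by the covariates. -/
def Vpar : Matrix (FactorialEffect K) (FactorialEffect K) ℝ := P.samplingCov P.Ypar

/-- The part of the sampling covariance not explained by the covariates. -/
def Vperp : Matrix (FactorialEffect K) (FactorialEffect K) ℝ := P.samplingCov P.Yperp

end FactorialPopulation

/-- The matrix roots in `V⊥^{1/2} ε + (V∥)^{1/2}_p ζ` are meaningful: `V⊥` and `V∥` are positive
semidefinite and `V∥` has rank at most `p`, the number of columns of its root. -/
def RootsMeaningful {ι : Type*} [Fintype ι] (Vperp Vpar : Matrix ι ι ℝ) (p : ℕ) : Prop :=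
  Vperp.PosSemidef ∧ Vpar.PosSemidef ∧ Vpar.rank ≤ p

/-- `B` is the positive semidefinite square root of `V`. -/
def IsPosSemidefRoot {ι : Type*} [Fintype ι] (B V : Matrix ι ι ℝ) : Prop :=
  B.PosSemidef ∧ B * Bᵀ = V

/-- `A` is a (generally not unique) matrix root `V^{1/2}_p` of `V`, with columns indexed by `κ`,
where `p` is the cardinality of `κ`. -/
def IsRectRoot {ι κ : Type*} [Fintype κ] (A : Matrix ι κ ℝ) (V : Matrix ι ι ℝ) : Prop :=
  A * Aᵀ = V

end

/-! ### Closed convex hulls of sets of distributions -/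

section Hull

variable {E E' : Type*} [TopologicalSpace E] [MeasurableSpace E] [OpensMeasurableSpace E]
  [TopologicalSpace E'] [MeasurableSpace E'] [BorelSpace E']

/-! The pair (ε, ζ) has joint density proportional to exp(-(|x|² + |y|²)/2) on |y|² ≤ a, whose
superlevel sets at positive heights are bounded, convex and symmetric. By the layer cake formula
such a law is a mixture of uniform laws on these sets, and discretizing the heights puts it in the
closed convex hull (`mem_hull_of_density`).

The hulls are stable under linear isomorphisms (`map_linearEquiv_mem_hull`) and under projections
(`map_fst_mem_hull`). For projections, one real coordinate is dropped at a time: the marginal of a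
uniform law on a body has the fibre length as density, and its superlevel sets are convex because
fibres are intervals (`convex_fibre_length`). Only this elementary one-dimensional Brunn–Minkowski
inequality is needed.

For invertible B, the law of Bε + Aζ is the first marginal of the image of (ε, ζ) under the
isomorphism (x, y) ↦ (Bx + Ay, y). A singular positive semidefinite B is the limit of the invertible
matrices B + δI, and the hull is weakly closed. This covers all four laws. The roots exist because
sampling covariances are positive semidefinite by Cauchy–Schwarz (`posSemidef_sum_inv_mul_sub`). -/

lemma subset_distClosedConvexHull (C : Set (ProbabilityMeasure E)) :
    C ⊆ distClosedConvexHull C :=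
  Set.subset_sInter fun _ hB => hB.1

lemma distClosedConvexHull_subset {C B : Set (ProbabilityMeasure E)} (h : C ⊆ B)
    (hB : IsClosedConvexSet B) : distClosedConvexHull C ⊆ B :=
  Set.sInter_subset_of_mem ⟨h, hB⟩

lemma isClosedConvexSet_distClosedConvexHull (C : Set (ProbabilityMeasure E)) :
    IsClosedConvexSet (distClosedConvexHull C) := by
  refine ⟨fun ν₁ h₁ ν₂ h₂ t ht0 ht1 ν hν B hB => ?_, fun u ν hu hν B hB => ?_⟩
  · exact hB.2.1 ν₁ (h₁ B hB) ν₂ (h₂ B hB) t ht0 ht1 ν hν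
  · exact hB.2.2 u ν (fun j => hu j B hB) hν

/-- Pushforward is affine in the measure and, for continuous maps, weakly continuous. -/
lemma IsClosedConvexSet.preimage_map {B : Set (ProbabilityMeasure E')} (hB : IsClosedConvexSet B)
    {f : E → E'} (hf : Continuous f) :
    IsClosedConvexSet {ν : ProbabilityMeasure E | ν.map hf.measurable.aemeasurable ∈ B} := by
  refine ⟨fun ν₁ h₁ ν₂ h₂ t ht0 ht1 ν hν => ?_, fun u ν hu hν => ?_⟩
  · refine hB.1 _ h₁ _ h₂ t ht0 ht1 _ ?_
    simp only [ProbabilityMeasure.toMeasure_map]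
    rw [hν, Measure.map_add _ _ hf.measurable, Measure.map_smul, Measure.map_smul]
  · exact hB.2 _ _ hu (ProbabilityMeasure.tendsto_map_of_tendsto_of_continuous _ _ hν hf)

/-- Pushing forward along a continuous map sends the hull of `C` into the hull of `C'`, as soon as
it sends `C` there. -/
lemma map_mem_distClosedConvexHull {C : Set (ProbabilityMeasure E)}
    {C' : Set (ProbabilityMeasure E')} {f : E → E'} (hf : Continuous f)
    (h : ∀ ν ∈ C, ν.map hf.measurable.aemeasurable ∈ distClosedConvexHull C')
    {ν : ProbabilityMeasure E} (hν : ν ∈ distClosedConvexHull C) :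
    ν.map hf.measurable.aemeasurable ∈ distClosedConvexHull C' :=
  distClosedConvexHull_subset
    (B := {ν | ν.map hf.measurable.aemeasurable ∈ distClosedConvexHull C'}) h
    ((isClosedConvexSet_distClosedConvexHull C').preimage_map hf) hν

end Hull

/-! ### Finite measures that normalize into a closed convex set -/

section Cone

open scoped NNReal

variable {E : Type*} [Nonempty E] [MeasurableSpace E] {B : Set (ProbabilityMeasure E)}

/-- The finite measures that are zero or whose normalization belongs to `B`. -/
def NormalizesInto (B : Set (ProbabilityMeasure E)) (μ : FiniteMeasure E) : Prop :=
  μ ≠ 0 → μ.normalize ∈ B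

lemma NormalizesInto.smul {μ : FiniteMeasure E} (hμ : NormalizesInto B μ) (c : ℝ≥0) :
    NormalizesInto B (c • μ) := by
  intro h
  have hc : c ≠ 0 := by rintro rfl; simp at h
  have h0 : μ ≠ 0 := by rintro rfl; simp at h
  convert hμ h0 using 1
  apply ProbabilityMeasure.eq_of_forall_apply_eq
  intro s _
  rw [FiniteMeasure.normalize_eq_of_nonzero _ h, FiniteMeasure.normalize_eq_of_nonzero _ h0]
  have : (c • μ).mass = c * μ.mass := FiniteMeasure.smul_apply c μ _
  rw [this]
  have h1 : μ.mass ≠ 0 := by simpa using h0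
  rw [FiniteMeasure.smul_apply, smul_eq_mul]
  field_simp

variable [TopologicalSpace E] [OpensMeasurableSpace E]

lemma NormalizesInto.add (hB : IsClosedConvexSet B) {μ ν : FiniteMeasure E}
    (hμ : NormalizesInto B μ) (hν : NormalizesInto B ν) : NormalizesInto B (μ + ν) := by
  by_cases h₁ : μ = 0
  · simpa [h₁] using hν
  by_cases h₂ : ν = 0
  · simpa [h₂] using hμ
  intro h
  have p₁ : 0 < μ.mass := pos_iff_ne_zero.2 (by simpa using h₁)
  have p₂ : 0 < ν.mass := pos_iff_ne_zero.2 (by simpa using h₂)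
  have hm : (μ + ν).mass = μ.mass + ν.mass := by
    rw [FiniteMeasure.mass, FiniteMeasure.coeFn_add]; rfl
  -- The normalized sum is the mixture of the two normalizations with weights proportional to the
  -- masses.
  set t : ℝ≥0 := ν.mass / (μ.mass + ν.mass) with ht
  have ht' : 1 - (t : ℝ) = ((μ.mass / (μ.mass + ν.mass) : ℝ≥0) : ℝ) := by
    have : (μ.mass : ℝ) + ν.mass ≠ 0 := by positivity
    rw [ht]; push_cast; field_simp; ring
  have htpos : 0 < t := by positivity
  have hspos : 0 < μ.mass / (μ.mass + ν.mass) := by positivity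
  refine hB.1 _ (hμ h₁) _ (hν h₂) t (by exact_mod_cast htpos) ?_ _ ?_
  · have : (0 : ℝ) < 1 - t := by rw [ht']; exact_mod_cast hspos
    linarith
  · rw [ht', ENNReal.ofReal_coe_nnreal, ENNReal.ofReal_coe_nnreal,
      FiniteMeasure.toMeasure_normalize_eq_of_nonzero _ h,
      FiniteMeasure.toMeasure_normalize_eq_of_nonzero _ h₁,
      FiniteMeasure.toMeasure_normalize_eq_of_nonzero _ h₂, hm, FiniteMeasure.toMeasure_add,
      smul_add]
    change _ = (μ.mass / (μ.mass + ν.mass)) • μ.mass⁻¹ • (μ : Measure E)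
      + t • ν.mass⁻¹ • (ν : Measure E)
    rw [smul_smul, smul_smul]
    congr 2
    · field_simp
    · rw [ht]; field_simp

lemma NormalizesInto.sum (hB : IsClosedConvexSet B) {κ : Type*} (s : Finset κ)
    {μ : κ → FiniteMeasure E} (h : ∀ k ∈ s, NormalizesInto B (μ k)) :
    NormalizesInto B (∑ k ∈ s, μ k) := by
  classical
  induction s using Finset.induction_on with
  | empty => intro h0; simp at h0
  | insert k s hk ih =>
    rw [Finset.sum_insert hk]
    exact (h k (Finset.mem_insert_self _ _)).add hB
      (ih fun j hj => h j (Finset.mem_insert_of_mem hj))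

/-- Normalization is continuous away from zero. If the limit is nonzero, the masses are eventually
nonzero, and a shift of the sequence discards the initial terms. -/
lemma NormalizesInto.of_tendsto (hB : IsClosedConvexSet B) {u : ℕ → FiniteMeasure E}
    {μ : FiniteMeasure E} (hu : ∀ j, NormalizesInto B (u j)) (h : Tendsto u atTop (𝓝 μ)) :
    NormalizesInto B μ := by
  intro hμ
  have h1 := FiniteMeasure.tendsto_normalize_of_tendsto h hμ
  have h2 : ∀ᶠ j in atTop, u j ≠ 0 := by
    have h3 : ∀ᶠ j in atTop, (u j).mass ≠ 0 :=
      h.mass.eventually_ne (by simpa using hμ)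
    filter_upwards [h3] with j hj
    simpa using hj
  obtain ⟨N, hN⟩ := eventually_atTop.1 h2
  exact hB.2 (fun j => (u (j + N)).normalize) _ (fun j => hu _ (hN _ (by omega)))
    ((tendsto_add_atTop_iff_nat N).2 h1)

end Cone

/-! ### Uniform distributions on symmetric convex bodies, and the layer cake decomposition -/

section LayerCake

open scoped NNReal

/-- A compact convex set with nonempty interior that is symmetric about the origin. -/
def IsSymmBody {E : Type*} [TopologicalSpace E] [AddCommGroup E] [Module ℝ E] (K : Set E) : Prop :=
  IsCompact K ∧ Convex ℝ K ∧ (interior K).Nonempty ∧ K = (fun v => -v) '' K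

/-- The probability measures obtained by conditioning `μ` on a symmetric convex body. -/
def uniformBodies {E : Type*} [TopologicalSpace E] [AddCommGroup E] [Module ℝ E]
    [MeasurableSpace E] (μ : Measure E) : Set (ProbabilityMeasure E) :=
  {ν | ∃ K, IsSymmBody K ∧ (ν : Measure E) = μ[|K]}

variable {E : Type*} [NormedAddCommGroup E] [NormedSpace ℝ E] [FiniteDimensional ℝ E]
  [MeasurableSpace E] [BorelSpace E] (μ : Measure E) [μ.IsAddHaarMeasure]

lemma closure_ae_eq_of_convex {S : Set E} (hS : Convex ℝ S) : closure S =ᵐ[μ] S := by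
  refine (ae_eq_set.2 ⟨?_, ?_⟩)
  · refine measure_mono_null (fun x hx => ?_) (hS.addHaar_frontier μ)
    exact ⟨hx.1, fun h => hx.2 (interior_subset h)⟩
  · rw [Set.sdiff_eq_empty.2 subset_closure, measure_empty]

/-- The frontier of a convex set is null. So S may be replaced by its closure, which is compact, and
positive measure forces nonempty interior, since otherwise S would lie in its frontier. -/
lemma normalizesInto_restrict {S : Set E} (hconv : Convex ℝ S) (hsymm : ∀ x ∈ S, -x ∈ S)
    (hbdd : Bornology.IsBounded S) (ρ : FiniteMeasure E) (hρ : (ρ : Measure E) = μ.restrict S) :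
    NormalizesInto (distClosedConvexHull (uniformBodies μ)) ρ := by
  intro h0
  have hmass : (ρ.mass : ℝ≥0∞) = μ S := by
    rw [FiniteMeasure.ennreal_mass, hρ, Measure.restrict_apply_univ]
  have hpos : μ S ≠ 0 := by
    rw [← hmass, Ne, ENNReal.coe_eq_zero]
    simpa using h0
  have hint : (interior S).Nonempty := by
    by_contra hne
    rw [Set.not_nonempty_iff_eq_empty] at hne
    refine hpos (measure_mono_null (fun x hx => ?_) (hconv.addHaar_frontier μ))
    exact ⟨subset_closure hx, by simp [hne]⟩
  have hae := closure_ae_eq_of_convex μ hconv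
  have hneg : ∀ x ∈ closure S, -x ∈ closure S := by
    intro x hx
    exact map_mem_closure continuous_neg hx hsymm
  refine subset_distClosedConvexHull _ ⟨closure S, ⟨hbdd.isCompact_closure, hconv.closure,
    hint.mono (interior_mono subset_closure), ?_⟩, ?_⟩
  · ext x
    refine ⟨fun hx => ⟨-x, hneg x hx, neg_neg x⟩, ?_⟩
    rintro ⟨y, hy, rfl⟩
    exact hneg y hy
  · rw [FiniteMeasure.toMeasure_normalize_eq_of_nonzero _ h0, ProbabilityTheory.cond, measure_congr hae,
      Measure.restrict_congr_set hae, hρ, ← hmass, ← ENNReal.coe_inv (by simpa using h0)]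
    rfl

lemma sum_indicator_eq_floor {y : ℝ} {N : ℕ} (hN : y ≤ N) :
    ∑ k ∈ Finset.range N, (if ((k : ℝ) + 1 ≤ y) then (1 : ℝ≥0∞) else 0) = (⌊y⌋₊ : ℝ≥0∞) := by
  rw [← Finset.sum_filter, Finset.sum_const, nsmul_eq_mul, mul_one]
  congr 1
  have : (Finset.range N).filter (fun k : ℕ => (k : ℝ) + 1 ≤ y) = Finset.range ⌊y⌋₊ := by
    ext k
    have h1 : (k : ℝ) + 1 ≤ y ↔ k < ⌊y⌋₊ := by
      rw [← Nat.succ_le_iff, Nat.le_floor_iff' (Nat.succ_ne_zero k)]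
      push_cast; rfl
    simp only [Finset.mem_filter, Finset.mem_range, h1, and_iff_right_iff_imp]
    intro hk
    have h2 : ((⌊y⌋₊ : ℕ) : ℝ) ≤ N := by
      exact_mod_cast Nat.floor_le_of_le hN
    exact lt_of_lt_of_le hk (by exact_mod_cast h2)
  rw [this, Finset.card_range]

/-- **Layer cake decomposition.** A finite measure whose density has bounded convex symmetric
superlevel sets normalizes into the hull of the uniform distributions on symmetric convex
bodies. -/
lemma normalizesInto_withDensity {f : E → ℝ} (hf : Measurable f) (h0 : ∀ x, 0 ≤ f x)
    (hconv : ∀ t, 0 < t → Convex ℝ {x | t ≤ f x})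
    (hsymm : ∀ x, f (-x) = f x)
    (hbdd : ∀ t, 0 < t → Bornology.IsBounded {x | t ≤ f x})
    (ρ : FiniteMeasure E) (hρ : (ρ : Measure E) = μ.withDensity fun x => ENNReal.ofReal (f x)) :
    NormalizesInto (distClosedConvexHull (uniformBodies μ)) ρ := by
  have hfin : ∀ t, 0 < t → IsFiniteMeasure (μ.restrict {x | t ≤ f x}) := fun t ht =>
    ⟨by rw [Measure.restrict_apply_univ]; exact (hbdd t ht).measure_lt_top⟩
  have hms : ∀ t, MeasurableSet {x | t ≤ f x} := fun t => measurableSet_le measurable_const hf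
  have ht : ∀ n k : ℕ, 0 < ((k : ℝ) + 1) / (n + 1) := fun n k => by positivity
  let S : ℕ → ℕ → FiniteMeasure E := fun n k => ⟨_, hfin _ (ht n k)⟩
  -- Riemann sum of the layer cake integral with mesh 1/(n+1); the (n+1)² levels reach height n+1.
  -- Its density `g n` is ⌊(n+1) f⌋/(n+1), capped at n+1.
  let u : ℕ → FiniteMeasure E := fun n =>
    ((n : ℝ≥0) + 1)⁻¹ • ∑ k ∈ Finset.range ((n + 1) ^ 2), S n k
  let g : ℕ → E → ℝ≥0∞ := fun n x => (((n : ℝ≥0) + 1)⁻¹ : ℝ≥0) *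
    ∑ k ∈ Finset.range ((n + 1) ^ 2), (if ((k : ℝ) + 1 ≤ f x * (n + 1)) then (1 : ℝ≥0∞) else 0)
  have hmeas : ∀ (n k : ℕ), Measurable fun x =>
      (if ((k : ℝ) + 1 ≤ f x * (n + 1)) then (1 : ℝ≥0∞) else 0) := fun n k =>
    Measurable.ite (measurableSet_le measurable_const (by fun_prop)) measurable_const
      measurable_const
  have hg : ∀ n, Measurable (g n) := fun n =>
    (Finset.measurable_sum _ fun k _ => hmeas n k).const_mul _
  have hu : ∀ n, ((u n : FiniteMeasure E) : Measure E) = μ.withDensity (g n) := by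
    intro n
    have h1 : ((u n : FiniteMeasure E) : Measure E)
        = (((n : ℝ≥0) + 1)⁻¹ : ℝ≥0) • ∑ k ∈ Finset.range ((n + 1) ^ 2),
          μ.restrict {x | ((k : ℝ) + 1) / (n + 1) ≤ f x} := by
      simp only [u, FiniteMeasure.toMeasure_smul, FiniteMeasure.toMeasure_sum]
      rfl
    ext s hs
    rw [h1, withDensity_apply _ hs]
    simp only [g]
    rw [lintegral_const_mul _ (Finset.measurable_sum _ fun k _ => hmeas n k),
      lintegral_finsetSum _ fun k _ => hmeas n k]
    simp only [Measure.smul_apply, Measure.finsetSum_apply, ENNReal.smul_def, smul_eq_mul]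
    congr 1
    refine Finset.sum_congr rfl fun k _ => ?_
    have h2 : (fun x => (if ((k : ℝ) + 1 ≤ f x * (n + 1)) then (1 : ℝ≥0∞) else 0))
        = {x | ((k : ℝ) + 1) / (n + 1) ≤ f x}.indicator 1 := by
      ext x
      rw [Set.indicator_apply]
      congr 1
      simp only [Set.mem_ofPred_eq, eq_iff_iff]
      rw [div_le_iff₀ (by positivity)]
    rw [h2, lintegral_indicator_one (hms _), Measure.restrict_apply hs,
      Measure.restrict_apply (hms _), Set.inter_comm]
  have hgle : ∀ n x, g n x ≤ ENNReal.ofReal (f x) := by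
    intro n x
    have h1 : ∑ k ∈ Finset.range ((n + 1) ^ 2),
        (if ((k : ℝ) + 1 ≤ f x * (n + 1)) then (1 : ℝ≥0∞) else 0)
        ≤ ENNReal.ofReal (f x * (n + 1)) := by
      -- Adding levels only increases the sum, and with enough of them it equals the floor.
      obtain ⟨N, hN⟩ := exists_nat_ge (f x * (n + 1))
      calc _ ≤ ∑ k ∈ Finset.range (max N ((n + 1) ^ 2)),
            (if ((k : ℝ) + 1 ≤ f x * (n + 1)) then (1 : ℝ≥0∞) else 0) :=
            Finset.sum_le_sum_of_subset (Finset.range_mono (le_max_right _ _))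
        _ = (⌊f x * (n + 1)⌋₊ : ℝ≥0∞) :=
            sum_indicator_eq_floor (hN.trans (by exact_mod_cast le_max_left _ _))
        _ ≤ _ := by
            rw [← ENNReal.ofReal_natCast]
            exact ENNReal.ofReal_le_ofReal (Nat.floor_le (mul_nonneg (h0 x) (by positivity)))
    calc g n x ≤ (((n : ℝ≥0) + 1)⁻¹ : ℝ≥0) * ENNReal.ofReal (f x * (n + 1)) := by
          exact mul_le_mul_right h1 _
      _ = ENNReal.ofReal (f x) := by
          rw [← ENNReal.ofReal_coe_nnreal, ← ENNReal.ofReal_mul (by positivity)]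
          congr 1
          push_cast
          field_simp
  have hglim : ∀ x, Tendsto (fun n => g n x) atTop (𝓝 (ENNReal.ofReal (f x))) := by
    intro x
    have h1 : Tendsto (fun n : ℕ => ENNReal.ofReal ((⌊f x * ((n + 1 : ℕ) : ℝ)⌋₊ : ℝ) /
        ((n + 1 : ℕ) : ℝ))) atTop (𝓝 (ENNReal.ofReal (f x))) :=
      (ENNReal.continuous_ofReal.tendsto _).comp <|
        (tendsto_nat_floor_mul_div_atTop (h0 x)).comp <|
          tendsto_natCast_atTop_atTop.comp (tendsto_add_atTop_nat 1)
    refine h1.congr' ?_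
    -- Once n ≥ f x the cap is inactive, so the sum is exactly the floor.
    obtain ⟨N, hN⟩ := exists_nat_ge (f x)
    filter_upwards [eventually_ge_atTop N] with n hn
    have h2 : f x * ((n : ℝ) + 1) ≤ (((n + 1) ^ 2 : ℕ) : ℝ) := by
      have : (N : ℝ) ≤ n := by exact_mod_cast hn
      push_cast
      nlinarith
    simp only [g]
    rw [sum_indicator_eq_floor h2, ← ENNReal.ofReal_natCast, ← ENNReal.ofReal_coe_nnreal,
      ← ENNReal.ofReal_mul (by positivity)]
    congr 1
    push_cast
    field_simp
  refine NormalizesInto.of_tendsto (isClosedConvexSet_distClosedConvexHull _) (u := u)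
    (fun n => ?_) ?_
  · refine (NormalizesInto.sum (isClosedConvexSet_distClosedConvexHull _) _ fun k _ => ?_).smul _
    exact normalizesInto_restrict μ (hconv _ (ht n k))
      (fun x hx => by simpa only [Set.mem_ofPred_eq, hsymm] using hx) (hbdd _ (ht n k)) _ rfl
  · rw [FiniteMeasure.tendsto_iff_forall_lintegral_tendsto]
    intro φ
    have hφ : Measurable fun x => (φ x : ℝ≥0∞) := φ.continuous.measurable.coe_nnreal_ennreal
    simp only [hu, hρ]
    have hdens : ∀ h : E → ℝ≥0∞, Measurable h →
        ∫⁻ x, φ x ∂(μ.withDensity h) = ∫⁻ x, h x * φ x ∂μ := fun h hh => by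
      rw [lintegral_withDensity_eq_lintegral_mul _ hh hφ]; rfl
    simp only [hdens _ (hg _), hdens _ hf.ennreal_ofReal]
    -- The dominating function f φ is integrable because ρ is finite and φ is bounded.
    refine tendsto_lintegral_of_dominated_convergence
      (fun x => ENNReal.ofReal (f x) * φ x) (fun n => (hg n).mul hφ)
      (fun n => Eventually.of_forall fun x => mul_le_mul_left (hgle n x) _) ?_
      (Eventually.of_forall fun x =>
        ENNReal.Tendsto.mul_const (hglim x) (Or.inr ENNReal.coe_ne_top))
    rw [← hdens _ hf.ennreal_ofReal, ← hρ]
    exact (φ.lintegral_lt_top_of_nnreal _).ne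

/-- A probability measure whose density is proportional to a function with bounded convex
symmetric superlevel sets. -/
lemma mem_hull_of_density {f : E → ℝ} (hf : Measurable f) (h0 : ∀ x, 0 ≤ f x)
    (hconv : ∀ t, 0 < t → Convex ℝ {x | t ≤ f x})
    (hsymm : ∀ x, f (-x) = f x)
    (hbdd : ∀ t, 0 < t → Bornology.IsBounded {x | t ≤ f x})
    (ν : ProbabilityMeasure E) (c : ℝ≥0∞) (hc : c ≠ ∞)
    (hν : (ν : Measure E) = c • μ.withDensity fun x => ENNReal.ofReal (f x)) :
    ν ∈ distClosedConvexHull (uniformBodies μ) := by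
  set m := μ.withDensity fun x => ENNReal.ofReal (f x) with hm
  -- Total mass one forces c ≠ 0 and m finite.
  have h1 : c * m Set.univ = 1 := by
    have := measure_univ (μ := (ν : Measure E))
    rwa [hν, Measure.smul_apply, smul_eq_mul] at this
  have hc0 : c ≠ 0 := by rintro rfl; simp at h1
  have hfin : IsFiniteMeasure m := ⟨by
    by_contra h
    rw [not_lt, top_le_iff] at h
    rw [h, ENNReal.mul_top hc0] at h1
    exact ENNReal.top_ne_one h1⟩
  lift c to ℝ≥0 using hc
  let ρ : FiniteMeasure E := ⟨m, hfin⟩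
  have h2 := (normalizesInto_withDensity μ hf h0 hconv hsymm hbdd ρ rfl).smul c
  have h3 : c • ρ = ν.toFiniteMeasure := by
    apply Subtype.ext
    exact hν.symm
  rw [h3] at h2
  simpa using h2 ν.toFiniteMeasure_nonzero

end LayerCake

/-! ### Linear images -/

section LinearImages

lemma isCompact_convex_eq_Icc {s : Set ℝ} (hs : IsCompact s) (hc : Convex ℝ s)
    (hne : s.Nonempty) : ∃ l u, l ≤ u ∧ s = Set.Icc l u := by
  have h := eq_Icc_of_connected_compact ⟨hne, hc.isPreconnected⟩ hs
  refine ⟨_, _, ?_, h⟩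
  rw [h] at hne
  exact Set.nonempty_Icc.1 hne

/-- The length of the fibres of a convex body is concave where it does not vanish. -/
lemma convex_fibre_length {E : Type*} [NormedAddCommGroup E] [NormedSpace ℝ E]
    {K : Set (E × ℝ)} (hK : IsCompact K) (hc : Convex ℝ K) {t : ℝ}
    (ht : 0 < t) : Convex ℝ {z | t ≤ (volume (Prod.mk z ⁻¹' K)).toReal} := by
  have hcomp : ∀ z, IsCompact (Prod.mk z ⁻¹' K) := fun z =>
    (hK.image continuous_snd).of_isClosed_subset (hK.isClosed.preimage (by fun_prop))
      fun y hy => ⟨_, hy, rfl⟩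
  have hconv : ∀ z, Convex ℝ (Prod.mk z ⁻¹' K) := by
    intro z x hx y hy a b ha hb hab
    have := hc hx hy ha hb hab
    simp only [Prod.smul_mk, Prod.mk_add_mk, ← add_smul, hab, one_smul] at this
    exact this
  -- Since t > 0, such a fibre is nonempty, hence a compact interval.
  have hIcc : ∀ z, t ≤ (volume (Prod.mk z ⁻¹' K)).toReal →
      ∃ l u, l ≤ u ∧ Prod.mk z ⁻¹' K = Set.Icc l u := by
    intro z hz
    refine isCompact_convex_eq_Icc (hcomp z) (hconv z) ?_
    by_contra hne
    rw [Set.not_nonempty_iff_eq_empty] at hne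
    simp [hne] at hz
    linarith
  intro x hx y hy a b ha hb hab
  obtain ⟨l, u, hlu, h1⟩ := hIcc x hx
  obtain ⟨l', u', hlu', h2⟩ := hIcc y hy
  simp only [Set.mem_ofPred_eq] at hx hy ⊢
  rw [h1, Real.volume_Icc, ENNReal.toReal_ofReal (by linarith)] at hx
  rw [h2, Real.volume_Icc, ENNReal.toReal_ofReal (by linarith)] at hy
  -- By convexity of K, the fibre over ax + by contains a times the fibre over x plus b times the
  -- fibre over y; for intervals the lengths combine linearly.
  have hmem : ∀ p ∈ Set.Icc l u, ∀ q ∈ Set.Icc l' u',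
      a * p + b * q ∈ Prod.mk (a • x + b • y) ⁻¹' K := by
    intro p hp q hq
    rw [← h1] at hp
    rw [← h2] at hq
    exact hc hp hq ha hb hab
  have hsub : Set.Icc (a * l + b * l') (a * u + b * u') ⊆ Prod.mk (a • x + b • y) ⁻¹' K :=
    (hconv _).ordConnected.out (hmem l ⟨le_rfl, hlu⟩ l' ⟨le_rfl, hlu'⟩)
      (hmem u ⟨hlu, le_rfl⟩ u' ⟨hlu', le_rfl⟩)
  have hle := ENNReal.toReal_mono (hcomp (a • x + b • y)).measure_lt_top.ne
    (measure_mono (μ := volume) hsub)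
  have h3 : a * l ≤ a * u := mul_le_mul_of_nonneg_left hlu ha
  have h4 : b * l' ≤ b * u' := mul_le_mul_of_nonneg_left hlu' hb
  rw [Real.volume_Icc, ENNReal.toReal_ofReal (by linarith)] at hle
  refine le_trans ?_ hle
  have h5 : t = a * t + b * t := by rw [← add_mul, hab, one_mul]
  have h6 := mul_le_mul_of_nonneg_left hx ha
  have h7 := mul_le_mul_of_nonneg_left hy hb
  linarith

lemma IsSymmBody.image {E E' : Type*} [NormedAddCommGroup E] [NormedSpace ℝ E]
    [NormedAddCommGroup E'] [NormedSpace ℝ E'] {K : Set E} (hK : IsSymmBody K) (L : E ≃L[ℝ] E') :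
    IsSymmBody (L '' K) := by
  obtain ⟨h1, h2, h3, h4⟩ := hK
  refine ⟨h1.image L.continuous, h2.linear_image (L : E →ₗ[ℝ] E'), ?_, ?_⟩
  · have : interior (L '' K) = L '' interior K := (L.toHomeomorph.image_interior K).symm
    rw [this]
    exact h3.image _
  · conv_lhs => rw [h4]
    simp only [Set.image_image, map_neg]

variable {E : Type*} [NormedAddCommGroup E] [NormedSpace ℝ E]
  [MeasurableSpace E] [BorelSpace E] (μ : Measure E) [μ.IsAddHaarMeasure]
  {E' : Type*} [NormedAddCommGroup E'] [NormedSpace ℝ E'] [FiniteDimensional ℝ E']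
  [MeasurableSpace E'] [BorelSpace E'] (μ' : Measure E') [μ'.IsAddHaarMeasure]

/-- By uniqueness of Haar measure, the image of μ is a constant multiple of μ', and the constant
cancels in the normalization. -/
lemma map_cond_linearEquiv (L : E ≃L[ℝ] E') (K : Set E) :
    (μ[|K]).map L = μ'[|L '' K] := by
  have hL : MeasurableEmbedding L := L.toHomeomorph.measurableEmbedding
  have h1 : μ.map L = Measure.addHaarScalarFactor (μ.map L) μ' • μ' :=
    Measure.isAddLeftInvariant_eq_smul _ _
  set c := Measure.addHaarScalarFactor (μ.map L) μ' with hc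
  have hc0 : c ≠ 0 := (Measure.addHaarScalarFactor_pos_of_isAddHaarMeasure _ _).ne'
  have h2 : μ K = c * μ' (L '' K) := by
    have : (μ.map L) (L '' K) = μ K := by
      rw [hL.map_apply, Set.preimage_image_eq _ L.injective]
    rw [← this, h1, Measure.smul_apply]
    rfl
  have h3 : (μ.restrict K).map L = c • μ'.restrict (L '' K) := by
    rw [← Measure.restrict_smul, ← h1, hL.restrict_map, Set.preimage_image_eq _ L.injective]
  rw [ProbabilityTheory.cond, ProbabilityTheory.cond, Measure.map_smul, h3, h2, ENNReal.smul_def,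
    smul_smul, ENNReal.mul_inv (Or.inl (by simpa using hc0)) (Or.inl ENNReal.coe_ne_top),
    mul_right_comm, ENNReal.inv_mul_cancel (by simpa using hc0) ENNReal.coe_ne_top, one_mul]

lemma map_linearEquiv_mem_hull (L : E ≃L[ℝ] E') {ν : ProbabilityMeasure E}
    (hν : ν ∈ distClosedConvexHull (uniformBodies μ)) :
    ν.map L.continuous.measurable.aemeasurable ∈ distClosedConvexHull (uniformBodies μ') := by
  refine map_mem_distClosedConvexHull L.continuous ?_ hν
  rintro ν ⟨K, hK, hνK⟩
  refine subset_distClosedConvexHull _ ⟨L '' K, hK.image L, ?_⟩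
  rw [ProbabilityMeasure.toMeasure_map, hνK, map_cond_linearEquiv μ μ']

variable [FiniteDimensional ℝ E]

/-- By Fubini, the marginal of the uniform law on K has density proportional to the fibre length.
Its superlevel sets are convex by `convex_fibre_length`, bounded as subsets of the projection of K,
and symmetric because K is. -/
lemma map_fst_real_mem_hull {ν : ProbabilityMeasure (E × ℝ)}
    (hν : ν ∈ distClosedConvexHull (uniformBodies (μ.prod (volume : Measure ℝ)))) :
    ν.map continuous_fst.measurable.aemeasurable ∈ distClosedConvexHull (uniformBodies μ) := by
  refine map_mem_distClosedConvexHull continuous_fst ?_ hν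
  rintro ν ⟨K, ⟨hK, hc, hint, hsymm⟩, hνK⟩
  have hneg : ∀ p ∈ K, -p ∈ K := by
    intro p hp
    rw [hsymm]
    exact ⟨p, hp, rfl⟩
  have hKm : MeasurableSet K := hK.measurableSet
  have hfin : ∀ z, volume (Prod.mk z ⁻¹' K) ≠ ∞ := fun z =>
    ((hK.image continuous_snd).of_isClosed_subset (hK.isClosed.preimage (by fun_prop))
      fun y hy => ⟨_, hy, rfl⟩).measure_lt_top.ne
  have hpos : (μ.prod (volume : Measure ℝ)) K ≠ 0 :=
    (Measure.measure_pos_of_nonempty_interior _ hint).ne'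
  refine mem_hull_of_density μ (f := fun z => (volume (Prod.mk z ⁻¹' K)).toReal)
    (measurable_measure_prodMk_left hKm).ennreal_toReal (fun z => ENNReal.toReal_nonneg)
    (fun t ht => convex_fibre_length hK hc ht) (fun z => ?_) (fun t ht => ?_) _
    ((μ.prod (volume : Measure ℝ)) K)⁻¹ (ENNReal.inv_ne_top.2 hpos) ?_
  · have : Prod.mk (-z) ⁻¹' K = -(Prod.mk z ⁻¹' K) := by
      ext y
      simp only [Set.mem_preimage, Set.mem_neg]
      exact ⟨fun h => by simpa using hneg _ h, fun h => by simpa using hneg _ h⟩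
    simp only [this, Measure.measure_neg]
  · refine (hK.image continuous_fst).isBounded.subset fun z hz => ?_
    have hne : (Prod.mk z ⁻¹' K).Nonempty := by
      by_contra hne
      rw [Set.not_nonempty_iff_eq_empty] at hne
      simp [hne] at hz
      linarith
    obtain ⟨y, hy⟩ := hne
    exact ⟨_, hy, rfl⟩
  · rw [ProbabilityMeasure.toMeasure_map, hνK, ProbabilityTheory.cond, Measure.map_smul]
    congr 1
    ext s hs
    rw [Measure.map_apply measurable_fst hs, Measure.restrict_apply (measurable_fst hs),
      Measure.prod_apply ((measurable_fst hs).inter hKm), withDensity_apply _ hs,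
      ← lintegral_indicator hs]
    refine lintegral_congr fun z => ?_
    by_cases hz : z ∈ s
    · rw [Set.indicator_of_mem hz, ENNReal.ofReal_toReal (hfin z)]
      congr 1
      ext y
      simp [hz]
    · rw [Set.indicator_of_notMem hz]
      convert measure_empty (μ := (volume : Measure ℝ)) using 2
      ext y
      simp [hz]

lemma map_fst_pi_mem_hull (k : ℕ) {E : Type*} [NormedAddCommGroup E] [NormedSpace ℝ E]
    [FiniteDimensional ℝ E] [MeasurableSpace E] [BorelSpace E] (μ : Measure E)
    [μ.IsAddHaarMeasure] {ν : ProbabilityMeasure (E × (Fin k → ℝ))}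
    (hν : ν ∈ distClosedConvexHull (uniformBodies (μ.prod (volume : Measure (Fin k → ℝ))))) :
    ν.map continuous_fst.measurable.aemeasurable ∈ distClosedConvexHull (uniformBodies μ) := by
  induction k generalizing E with
  | zero =>
    exact map_linearEquiv_mem_hull _ μ (ContinuousLinearEquiv.prodUnique ℝ E (Fin 0 → ℝ)) hν
  | succ k ih =>
    -- Regroup so that E × ℝ takes the place of E: the induction hypothesis removes k coordinates
    -- and the one-dimensional case the last.
    let L : (E × (Fin (k + 1) → ℝ)) ≃L[ℝ] ((E × ℝ) × (Fin k → ℝ)) :=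
      ((ContinuousLinearEquiv.refl ℝ E).prodCongr (Fin.consEquivL ℝ fun _ => ℝ).symm).trans
        (ContinuousLinearEquiv.prodAssoc ℝ E ℝ (Fin k → ℝ)).symm
    have i1 : (μ.prod (volume : Measure ℝ)).IsAddHaarMeasure := inferInstance
    have i2 : ((μ.prod (volume : Measure ℝ)).prod
        (volume : Measure (Fin k → ℝ))).IsAddHaarMeasure :=
      Measure.prod.instIsAddHaarMeasure _ _
    have h1 := map_linearEquiv_mem_hull _ ((μ.prod (volume : Measure ℝ)).prod volume) L hν
    have h2 := map_fst_real_mem_hull μ (ih (μ.prod volume) h1)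
    convert h2 using 1
    apply Subtype.ext
    simp only [ProbabilityMeasure.val_eq_to_measure, ProbabilityMeasure.toMeasure_map]
    rw [Measure.map_map measurable_fst L.continuous.measurable,
      Measure.map_map measurable_fst (by fun_prop)]
    rfl

/-- The hulls of the uniform distributions on symmetric convex bodies are stable under
projections. -/
lemma map_fst_mem_hull {ν : ProbabilityMeasure (E × E')}
    (hν : ν ∈ distClosedConvexHull (uniformBodies (μ.prod μ'))) :
    ν.map continuous_fst.measurable.aemeasurable ∈ distClosedConvexHull (uniformBodies μ) := by
  let L : (E × E') ≃L[ℝ] (E × (Fin (Module.finrank ℝ E') → ℝ)) :=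
    (ContinuousLinearEquiv.refl ℝ E).prodCongr
      (ContinuousLinearEquiv.ofFinrankEq (by simp))
  have h := map_fst_pi_mem_hull _ μ (map_linearEquiv_mem_hull _ (μ.prod volume) L hν)
  convert h using 1
  apply Subtype.ext
  simp only [ProbabilityMeasure.val_eq_to_measure, ProbabilityMeasure.toMeasure_map]
  rw [Measure.map_map measurable_fst L.continuous.measurable]
  rfl

end LinearImages

/-! ### The Gaussian density -/

section GaussianDensity

open scoped NNReal

variable {E : Type*} [NormedAddCommGroup E] [InnerProductSpace ℝ E] [FiniteDimensional ℝ E]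
  [MeasurableSpace E] [BorelSpace E]

lemma integrable_exp_neg_sq_norm :
    Integrable fun x : E => Real.exp (-(‖x‖ ^ 2 / 2)) := by
  have h := GaussianFourier.integrable_cexp_neg_mul_sq_norm_add (V := E) (b := 1 / 2)
    (by norm_num) 0 0
  refine h.norm.congr (Eventually.of_forall fun x => ?_)
  have hx : -(1 / 2) * (‖x‖ : ℂ) ^ 2 + 0 * (inner ℝ 0 x : ℝ) = ((-(‖x‖ ^ 2 / 2) : ℝ) : ℂ) := by
    push_cast
    ring
  simp only [hx]
  rw [← Complex.ofReal_exp, Complex.norm_real, Real.norm_of_nonneg (Real.exp_pos _).le]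

/-- The standard Gaussian distribution has a density proportional to `exp (-‖x‖ ^ 2 / 2)`. -/
lemma exists_stdGaussian_eq_smul_withDensity :
    ∃ c : ℝ≥0, stdGaussian E
      = c • (volume : Measure E).withDensity fun x => ENNReal.ofReal (Real.exp (-(‖x‖ ^ 2 / 2))) := by
  set g : E → ℝ := fun x => Real.exp (-(‖x‖ ^ 2 / 2)) with hg
  have hgm : Measurable g := by fun_prop
  set m := (volume : Measure E).withDensity fun x => ENNReal.ofReal (g x) with hm
  have hfin : IsFiniteMeasure m := isFiniteMeasure_withDensity_ofReal
    integrable_exp_neg_sq_norm.2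
  -- The value of the integral of exp(-‖x‖²/2); the Fourier transform below shows that its inverse
  -- is the normalizing constant.
  set C : ℝ := (2 * Real.pi) ^ ((Module.finrank ℝ E : ℝ) / 2) with hC
  have hCpos : 0 < C := by positivity
  have hchar : ∀ t, charFun m t = C * Complex.exp (-‖t‖ ^ 2 / 2) := by
    intro t
    rw [charFun_apply, hm, integral_withDensity_eq_integral_toReal_smul hgm.ennreal_ofReal
      (Eventually.of_forall fun x => ENNReal.ofReal_lt_top)]
    have h := GaussianFourier.integral_cexp_neg_mul_sq_norm_add (V := E) (b := 1 / 2)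
      (by norm_num) Complex.I t
    convert h using 1
    · refine integral_congr_ae (Eventually.of_forall fun x => ?_)
      simp only
      rw [ENNReal.toReal_ofReal (Real.exp_pos _).le, Complex.real_smul, Complex.ofReal_exp,
        ← Complex.exp_add, real_inner_comm]
      congr 1
      push_cast
      ring
    · congr 1
      · rw [hC, Complex.ofReal_cpow (by positivity)]
        push_cast
        congr 1
        ring
      · congr 1
        rw [Complex.I_sq]
        ring
  refine ⟨(Real.toNNReal C)⁻¹, Measure.ext_of_charFun ?_⟩
  ext t
  rw [charFun_stdGaussian]
  have : charFun ((Real.toNNReal C)⁻¹ • m) t = (C : ℂ)⁻¹ * charFun m t := by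
    rw [charFun_apply, charFun_apply, integral_smul_nnreal_measure, NNReal.smul_def,
      Complex.real_smul, NNReal.coe_inv, Real.coe_toNNReal _ hCpos.le, Complex.ofReal_inv]
  rw [this, hchar, inv_mul_cancel_left₀ (by exact_mod_cast hCpos.ne')]

end GaussianDensity

/-! ### Linear combinations of Gaussian and truncated Gaussian vectors -/

section GaussianPlusTruncated

variable {ι κ : Type*} [Fintype ι] [Fintype κ]

lemma setOf_dotProduct_le_eq (a : ℝ) :
    {d : EuclideanSpace ℝ κ | d.ofLp ⬝ᵥ d.ofLp ≤ a} = {d | ‖d‖ ^ 2 ≤ a} := by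
  ext d
  rw [Set.mem_ofPred_eq, Set.mem_ofPred_eq, EuclideanSpace.real_norm_sq_eq]
  simp only [dotProduct, sq]

/-- The density is positive everywhere, and the set contains a nonempty open ball about the origin.
-/
lemma stdGaussian_sublevel_ne_zero {a : ℝ} (ha : 0 < a) :
    stdGaussian (EuclideanSpace ℝ κ) {d | d.ofLp ⬝ᵥ d.ofLp ≤ a} ≠ 0 := by
  obtain ⟨c, hc⟩ := exists_stdGaussian_eq_smul_withDensity (E := EuclideanSpace ℝ κ)
  have hc0 : c ≠ 0 := by
    rintro rfl
    have := measure_univ (μ := stdGaussian (EuclideanSpace ℝ κ))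
    rw [hc] at this
    simp at this
  rw [setOf_dotProduct_le_eq, hc]
  intro h
  have h1 : (volume.withDensity fun x : EuclideanSpace ℝ κ =>
      ENNReal.ofReal (Real.exp (-(‖x‖ ^ 2 / 2)))) {d | ‖d‖ ^ 2 ≤ a} = 0 := by
    rw [Measure.smul_apply, ENNReal.smul_def, smul_eq_mul, mul_eq_zero] at h
    exact h.resolve_left (by simpa using hc0)
  rw [withDensity_apply_eq_zero (by fun_prop)] at h1
  have h2 : IsOpen {d : EuclideanSpace ℝ κ | ‖d‖ ^ 2 < a} :=
    isOpen_lt (by fun_prop) continuous_const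
  refine (h2.measure_pos volume ⟨0, by simpa using ha⟩).ne' (measure_mono_null (fun x hx => ?_) h1)
  refine ⟨?_, (show ‖x‖ ^ 2 < a from hx).le⟩
  simpa using Real.exp_pos _

lemma isProbabilityMeasure_truncGaussian {a : ℝ} (ha : 0 < a) :
    IsProbabilityMeasure (truncGaussian κ a) :=
  cond_isProbabilityMeasure (stdGaussian_sublevel_ne_zero ha)

/-- Governs the level sets of the joint Gaussian density. It is not the squared norm of the product,
which carries the sup norm. -/
lemma convexOn_sq_norm_add_sq_norm {E F : Type*} [NormedAddCommGroup E] [NormedSpace ℝ E]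
    [NormedAddCommGroup F] [NormedSpace ℝ F] :
    ConvexOn ℝ Set.univ fun p : E × F => ‖p.1‖ ^ 2 + ‖p.2‖ ^ 2 := by
  have h1 : ConvexOn ℝ Set.univ fun x : E => ‖x‖ ^ 2 :=
    convexOn_univ_norm.pow (fun _ _ => norm_nonneg _) 2
  have h2 : ConvexOn ℝ Set.univ fun x : F => ‖x‖ ^ 2 :=
    convexOn_univ_norm.pow (fun _ _ => norm_nonneg _) 2
  exact (h1.comp_linearMap (LinearMap.fst ℝ E F)).add (h2.comp_linearMap (LinearMap.snd ℝ E F))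

lemma prod_truncGaussian_mem_hull {a : ℝ}
    (ν : ProbabilityMeasure (EuclideanSpace ℝ ι × EuclideanSpace ℝ κ))
    (hν : (ν : Measure _) = (stdGaussian (EuclideanSpace ℝ ι)).prod (truncGaussian κ a))
    (ha : 0 < a) :
    ν ∈ distClosedConvexHull (uniformBodies
      ((volume : Measure (EuclideanSpace ℝ ι)).prod (volume : Measure (EuclideanSpace ℝ κ)))) := by
  obtain ⟨c, hc⟩ := exists_stdGaussian_eq_smul_withDensity (E := EuclideanSpace ℝ ι)
  obtain ⟨d, hd⟩ := exists_stdGaussian_eq_smul_withDensity (E := EuclideanSpace ℝ κ)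
  set s : Set (EuclideanSpace ℝ κ) := {y | ‖y‖ ^ 2 ≤ a} with hs
  have hsm : MeasurableSet s := measurableSet_le (by fun_prop) measurable_const
  set e := (stdGaussian (EuclideanSpace ℝ κ) s)⁻¹ with he
  have hetop : e ≠ ∞ := by
    rw [he, hs, ← setOf_dotProduct_le_eq]
    exact ENNReal.inv_ne_top.2 (stdGaussian_sublevel_ne_zero ha)
  let f : EuclideanSpace ℝ ι × EuclideanSpace ℝ κ → ℝ :=
    (Prod.snd ⁻¹' s).indicator fun p => Real.exp (-((‖p.1‖ ^ 2 + ‖p.2‖ ^ 2) / 2))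
  -- Each superlevel set is a Euclidean ball (possibly empty) cut by the cylinder over the
  -- truncation ball.
  have hlevel : ∀ t, 0 < t → {p | t ≤ f p}
      = {p | ‖p.1‖ ^ 2 + ‖p.2‖ ^ 2 ≤ -(2 * Real.log t)} ∩ Prod.snd ⁻¹' s := by
    intro t ht
    ext p
    by_cases hp : p ∈ Prod.snd ⁻¹' s
    · simp only [f, Set.mem_ofPred_eq, Set.indicator_of_mem hp, Set.mem_inter_iff, hp, and_true]
      rw [← Real.log_le_iff_le_exp ht]
      constructor <;> intro h <;> linarith
    · simp only [f, Set.mem_ofPred_eq, Set.indicator_of_notMem hp, Set.mem_inter_iff, hp,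
        and_false, iff_false, not_le, ht]
  refine mem_hull_of_density _ (f := f) ?_ ?_ (fun t ht => ?_) (fun p => ?_) (fun t ht => ?_) ν
    ((c : ℝ≥0∞) * (e * d)) (ENNReal.mul_ne_top ENNReal.coe_ne_top
      (ENNReal.mul_ne_top hetop ENNReal.coe_ne_top)) ?_
  · exact Measurable.indicator (by fun_prop) (measurable_snd hsm)
  · exact fun p => Set.indicator_nonneg (fun _ _ => (Real.exp_pos _).le) _
  · rw [hlevel t ht]
    have h1 := (convexOn_sq_norm_add_sq_norm (E := EuclideanSpace ℝ ι)
      (F := EuclideanSpace ℝ κ)).convex_le (-(2 * Real.log t))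
    have h2 : Convex ℝ s := by
      have h : ConvexOn ℝ Set.univ fun x : EuclideanSpace ℝ κ => ‖x‖ ^ 2 :=
        convexOn_univ_norm.pow (fun _ _ => norm_nonneg _) 2
      simpa [hs] using h.convex_le a
    simp only [Set.mem_univ, true_and] at h1
    exact h1.inter (h2.linear_preimage (LinearMap.snd ℝ _ _))
  · have hmem : -p ∈ Prod.snd ⁻¹' s ↔ p ∈ Prod.snd ⁻¹' s := by simp [hs]
    by_cases hp : p ∈ Prod.snd ⁻¹' s
    · simp [f, Set.indicator_of_mem hp, Set.indicator_of_mem (hmem.2 hp)]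
    · simp [f, Set.indicator_of_notMem hp, Set.indicator_of_notMem (mt hmem.1 hp)]
  · rw [hlevel t ht]
    refine (Metric.isBounded_closedBall (x := 0) (r := √(-(2 * Real.log t)))).subset ?_
    rintro p ⟨hp, -⟩
    simp only [Set.mem_ofPred_eq] at hp
    rw [mem_closedBall_zero_iff, Prod.norm_def]
    exact max_le (Real.le_sqrt_of_sq_le (by nlinarith [sq_nonneg ‖p.2‖]))
      (Real.le_sqrt_of_sq_le (by nlinarith [sq_nonneg ‖p.1‖]))
  · have htr : truncGaussian κ a = (e * d) • volume.withDensity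
        (s.indicator fun y => ENNReal.ofReal (Real.exp (-(‖y‖ ^ 2 / 2)))) := by
      rw [truncGaussian, setOf_dotProduct_le_eq, ProbabilityTheory.cond, ← hs, ← he, hd,
        withDensity_indicator hsm, ← restrict_withDensity hsm, mul_smul]
      congr 1
      exact Measure.restrict_smul _ _ _
    rw [hν, htr, hc, ENNReal.smul_def, Measure.prod_smul_left, Measure.prod_smul_right, smul_smul,
      prod_withDensity (by fun_prop) (Measurable.indicator (by fun_prop) hsm)]
    congr 2
    funext p
    by_cases hp : p.2 ∈ s
    · have hp' : p ∈ Prod.snd ⁻¹' s := hp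
      simp only [f, Set.indicator_of_mem hp, Set.indicator_of_mem hp']
      rw [← ENNReal.ofReal_mul (Real.exp_pos _).le, ← Real.exp_add]
      congr 2
      ring
    · have hp' : p ∉ Prod.snd ⁻¹' s := hp
      simp [f, Set.indicator_of_notMem hp, Set.indicator_of_notMem hp']

/-- The linear map `(x, y) ↦ B x + A y`. -/
def gaussianPlusTruncMap (B : Matrix ι ι ℝ) (A : Matrix ι κ ℝ) :
    EuclideanSpace ℝ ι × EuclideanSpace ℝ κ →ₗ[ℝ] EuclideanSpace ℝ ι where
  toFun p := WithLp.toLp 2 (B *ᵥ p.1.ofLp + A *ᵥ p.2.ofLp)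
  map_add' p q := by
    rw [← WithLp.toLp_add]
    congr 1
    simp only [Prod.fst_add, Prod.snd_add, WithLp.ofLp_add, Matrix.mulVec_add]
    abel
  map_smul' c p := by
    rw [RingHom.id_apply, ← WithLp.toLp_smul]
    congr 1
    simp only [Prod.smul_fst, Prod.smul_snd, WithLp.ofLp_smul, Matrix.mulVec_smul, smul_add]

lemma continuous_gaussianPlusTruncMap (B : Matrix ι ι ℝ) (A : Matrix ι κ ℝ) :
    Continuous (gaussianPlusTruncMap B A) :=
  LinearMap.continuous_of_finiteDimensional _

lemma map_gaussianPlusTruncMap_mem_hull [DecidableEq ι] {B : Matrix ι ι ℝ} (hB : IsUnit B)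
    (A : Matrix ι κ ℝ) {ν : ProbabilityMeasure (EuclideanSpace ℝ ι × EuclideanSpace ℝ κ)}
    (hν : ν ∈ distClosedConvexHull (uniformBodies
      ((volume : Measure (EuclideanSpace ℝ ι)).prod (volume : Measure (EuclideanSpace ℝ κ))))) :
    ν.map (continuous_gaussianPlusTruncMap B A).measurable.aemeasurable
      ∈ distClosedConvexHull (uniformSymmConvexBody ι) := by
  -- Keeping y as second component makes (x, y) ↦ (Bx + Ay, y) invertible for any A.
  let T := (gaussianPlusTruncMap B A).prod (LinearMap.snd ℝ _ _)
  have hT : Function.Injective T := by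
    rw [← LinearMap.ker_eq_bot, LinearMap.ker_eq_bot']
    rintro ⟨x, y⟩ h
    obtain ⟨h1, h2⟩ := Prod.ext_iff.1 h
    have h2 : y = 0 := h2
    subst h2
    have h3 : B *ᵥ x.ofLp = 0 := by
      have := congrArg WithLp.ofLp h1
      simpa [T, gaussianPlusTruncMap] using this
    have h4 : x.ofLp = 0 := Matrix.mulVec_injective_of_isUnit hB (by simpa using h3)
    have h5 : x = 0 := by ext i; simpa using congrFun h4 i
    rw [h5]
    rfl
  let L := (LinearEquiv.ofInjectiveEndo T hT).toContinuousLinearEquiv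
  have h := map_fst_mem_hull _ _ (map_linearEquiv_mem_hull _
    ((volume : Measure (EuclideanSpace ℝ ι)).prod (volume : Measure (EuclideanSpace ℝ κ))) L hν)
  change _ ∈ distClosedConvexHull (uniformBodies (volume : Measure (EuclideanSpace ℝ ι)))
  convert h using 1
  apply Subtype.ext
  simp only [ProbabilityMeasure.val_eq_to_measure, ProbabilityMeasure.toMeasure_map]
  rw [Measure.map_map measurable_fst L.continuous.measurable]
  rfl

/-- If `B` is positive semidefinite and `A` is arbitrary, `B ε + A ζ` is central convex
unimodal. -/
theorem isCentralConvexUnimodal_gaussianPlusTruncLaw {B : Matrix ι ι ℝ} (hB : B.PosSemidef)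
    (A : Matrix ι κ ℝ) {a : ℝ} (ha : 0 < a) :
    IsCentralConvexUnimodal (gaussianPlusTruncLaw B A a) := by
  classical
  have := isProbabilityMeasure_truncGaussian (κ := κ) ha
  let ν : ProbabilityMeasure (EuclideanSpace ℝ ι × EuclideanSpace ℝ κ) :=
    ⟨(stdGaussian (EuclideanSpace ℝ ι)).prod (truncGaussian κ a), inferInstance⟩
  have hν := prod_truncGaussian_mem_hull ν rfl ha
  let δ : ℕ → ℝ := fun j => 1 / ((j : ℝ) + 1)
  -- Positive definite, hence invertible. The maps converge pointwise as δ → 0, which gives weak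
  -- convergence of the images of the fixed law ν.
  let C : ℕ → Matrix ι ι ℝ := fun j => B + δ j • (1 : Matrix ι ι ℝ)
  have hC : ∀ j, IsUnit (C j) := fun j =>
    (Matrix.PosDef.posSemidef_add hB (Matrix.PosDef.one.smul (by positivity))).isUnit
  have hlim : ∀ p, Tendsto (fun j => gaussianPlusTruncMap (C j) A p) atTop
      (𝓝 (gaussianPlusTruncMap B A p)) := by
    intro p
    have h1 : ∀ j, gaussianPlusTruncMap (C j) A p = gaussianPlusTruncMap B A p + δ j • p.1 := by
      intro j
      ext i
      simp [gaussianPlusTruncMap, C, Matrix.add_mulVec, Matrix.smul_mulVec]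
      ring
    simp only [h1]
    have h2 : Tendsto δ atTop (𝓝 0) := tendsto_one_div_add_atTop_nhds_zero_nat
    simpa using tendsto_const_nhds.add (h2.smul_const p.1)
  refine ⟨ν.map (continuous_gaussianPlusTruncMap B A).measurable.aemeasurable, ?_, rfl⟩
  refine (isClosedConvexSet_distClosedConvexHull _).2
    (fun j => ν.map (continuous_gaussianPlusTruncMap (C j) A).measurable.aemeasurable) _
    (fun j => map_gaussianPlusTruncMap_mem_hull (hC j) A hν) ?_
  rw [ProbabilityMeasure.tendsto_iff_forall_integral_tendsto]
  intro g
  simp only [ProbabilityMeasure.toMeasure_map]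
  have hmap : ∀ D : Matrix ι ι ℝ,
      ∫ x, g x ∂((ν : Measure _).map (gaussianPlusTruncMap D A))
        = ∫ p, g (gaussianPlusTruncMap D A p) ∂(ν : Measure _) := fun D =>
    integral_map (continuous_gaussianPlusTruncMap D A).measurable.aemeasurable
      g.continuous.aestronglyMeasurable
  simp only [hmap]
  refine tendsto_integral_of_dominated_convergence (fun _ => ‖g‖) (fun j => ?_)
    (integrable_const _) (fun j => Eventually.of_forall fun p => g.norm_coe_le_norm _)
    (Eventually.of_forall fun p => (g.continuous.tendsto _).comp (hlim p))
  exact (g.continuous.comp (continuous_gaussianPlusTruncMap (C j) A)).aestronglyMeasurable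

lemma isCentralConvexUnimodal_stdGaussian :
    IsCentralConvexUnimodal (stdGaussian (EuclideanSpace ℝ ι)) := by
  classical
  have h := isCentralConvexUnimodal_gaussianPlusTruncLaw (Matrix.PosSemidef.one (n := ι))
    (0 : Matrix ι ι ℝ) one_pos
  have := isProbabilityMeasure_truncGaussian (κ := ι) one_pos
  convert h
  rw [gaussianPlusTruncLaw]
  simp only [Matrix.one_mulVec, Matrix.zero_mulVec, add_zero]
  exact Measure.fst_prod.symm

lemma isCentralConvexUnimodal_truncGaussian {a : ℝ} (ha : 0 < a) :
    IsCentralConvexUnimodal (truncGaussian κ a) := by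
  classical
  have h := isCentralConvexUnimodal_gaussianPlusTruncLaw (Matrix.PosSemidef.zero (n := κ))
    (1 : Matrix κ κ ℝ) ha
  have := isProbabilityMeasure_truncGaussian (κ := κ) ha
  convert h
  rw [gaussianPlusTruncLaw]
  simp only [Matrix.one_mulVec, Matrix.zero_mulVec, zero_add]
  exact Measure.snd_prod.symm

end GaussianPlusTruncated

/-! ### Sampling covariances of factorial populations -/

section SamplingCovariance

/-- The quadratic form at c is ∑ aₖ²/sₖ - (∑ aₖ)²/∑ sₖ with aₖ = ∑ cᵢ Gᵢₖ, nonnegative by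
Cauchy–Schwarz. -/
lemma posSemidef_sum_inv_mul_sub {ι q : Type*} [Fintype ι] [Fintype q] (G : ι → q → ℝ)
    {s : q → ℝ} (hs : ∀ k, 0 < s k) :
    (Matrix.of fun i j => ∑ k, (s k)⁻¹ * (G i k * G j k)
      - (∑ k, s k)⁻¹ * ((∑ k, G i k) * ∑ k, G j k)).PosSemidef := by
  refine Matrix.PosSemidef.of_dotProduct_mulVec_nonneg ?_ fun c => ?_
  · ext i j
    simp [mul_comm]
  · have h := Finset.sq_sum_div_le_sum_sq_div Finset.univ (fun k => ∑ i, c i * G i k)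
      (g := s) (fun k _ => hs k)
    have h1 : ∑ i, c i * ∑ k, G i k = ∑ k, ∑ i, c i * G i k := by
      simp only [Finset.mul_sum]
      exact Finset.sum_comm
    have h2 : ∑ i, ∑ j, c i * c j * ∑ k, (s k)⁻¹ * (G i k * G j k)
        = ∑ k, (∑ i, c i * G i k) ^ 2 / s k := by
      simp only [Finset.mul_sum]
      calc _ = ∑ i, ∑ k, ∑ j, c i * c j * ((s k)⁻¹ * (G i k * G j k)) :=
            Finset.sum_congr rfl fun i _ => Finset.sum_comm
        _ = ∑ k, ∑ i, ∑ j, c i * c j * ((s k)⁻¹ * (G i k * G j k)) := Finset.sum_comm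
        _ = _ := by
          refine Finset.sum_congr rfl fun k _ => ?_
          rw [sq, Finset.sum_mul_sum, Finset.sum_div]
          refine Finset.sum_congr rfl fun i _ => ?_
          rw [Finset.sum_div]
          refine Finset.sum_congr rfl fun j _ => ?_
          rw [div_eq_mul_inv]
          ring
    have h3 : star c ⬝ᵥ ((Matrix.of fun i j => ∑ k, (s k)⁻¹ * (G i k * G j k)
        - (∑ k, s k)⁻¹ * ((∑ k, G i k) * ∑ k, G j k)) *ᵥ c)
        = ∑ k, (∑ i, c i * G i k) ^ 2 / s k - (∑ k, ∑ i, c i * G i k) ^ 2 / ∑ k, s k := by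
      rw [← h2, ← h1, sq, Finset.sum_mul_sum, Finset.sum_div, ← Finset.sum_sub_distrib]
      simp only [dotProduct, Matrix.mulVec, Matrix.of_apply, Pi.star_apply, star_trivial]
      refine Finset.sum_congr rfl fun i _ => ?_
      rw [Finset.sum_div, ← Finset.sum_sub_distrib, Finset.mul_sum]
      refine Finset.sum_congr rfl fun j _ => ?_
      rw [div_eq_mul_inv]
      ring
    rw [h3]
    linarith

lemma popMean_sum_mul {n : ℕ} {q : Type*} [Fintype q] (r : ℝ) (g : q → ℝ) (y : Fin n → q → ℝ) :
    popMean (fun i => r * ∑ k, g k * y i k) = r * ∑ k, g k * popMean fun i => y i k := by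
  simp only [popMean, Finset.mul_sum]
  rw [Finset.sum_comm]
  refine Finset.sum_congr rfl fun k _ => Finset.sum_congr rfl fun i _ => ?_
  ring

variable {K L : ℕ}

namespace FactorialPopulation

variable (P : FactorialPopulation K L)

lemma one_le_n : (1 : ℝ) ≤ P.n := by
  have h : 0 < ∑ q, P.size q := Finset.sum_pos (fun q _ => P.size_pos q) Finset.univ_nonempty
  rw [P.sum_size] at h
  exact_mod_cast h

lemma indEffect_sub_popMean (y : Fin P.n → Treatment K → ℝ) (f : FactorialEffect K)
    (i : Fin P.n) :
    P.indEffect y f i - popMean (P.indEffect y f)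
      = ((2 : ℝ) ^ (K - 1))⁻¹ * ∑ q, gen f q * (y i q - popMean fun j => y j q) := by
  have h : popMean (P.indEffect y f)
      = ((2 : ℝ) ^ (K - 1))⁻¹ * ∑ q, gen f q * popMean fun j => y j q :=
    popMean_sum_mul _ _ _
  rw [h, indEffect, ← mul_sub, ← Finset.sum_sub_distrib]
  simp only [mul_sub]

/-- The sampling covariance of the factorial effect estimators is positive semidefinite for every
outcome table. -/
lemma samplingCov_posSemidef (y : Fin P.n → Treatment K → ℝ) : (P.samplingCov y).PosSemidef := by
  set d : Fin P.n → Treatment K → ℝ := fun i q => y i q - popMean fun j => y j q with hd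
  set r : ℝ := ((2 : ℝ) ^ (K - 1))⁻¹ with hr
  have hr2 : ((2 : ℝ) ^ (2 * (K - 1)))⁻¹ = r * r := by
    rw [hr, ← mul_inv, ← pow_add, two_mul]
  have hn : ∑ q, (P.size q : ℝ) = P.n := by exact_mod_cast P.sum_size
  -- Split the covariance unit by unit; since the group sizes sum to n, each unit contributes a
  -- matrix of the Cauchy–Schwarz form.
  have h : P.samplingCov y = (r * r * ((P.n : ℝ) - 1)⁻¹) • ∑ i, Matrix.of fun f f' =>
      ∑ q, (P.size q : ℝ)⁻¹ * ((gen f q * d i q) * (gen f' q * d i q))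
        - (∑ q, (P.size q : ℝ))⁻¹ * ((∑ q, gen f q * d i q) * ∑ q, gen f' q * d i q) := by
    ext f f'
    rw [hn]
    simp only [samplingCov, popCov, indEffect_sub_popMean, Matrix.of_apply, Matrix.smul_apply,
      Matrix.sum_apply, smul_eq_mul, Finset.sum_sub_distrib, mul_sub (r * r * _), hr2, ← hr]
    congr 1
    · rw [Finset.sum_comm]
      simp only [Finset.mul_sum]
      refine Finset.sum_congr rfl fun q _ => Finset.sum_congr rfl fun i _ => ?_
      ring
    · rw [Finset.mul_sum, Finset.mul_sum, Finset.mul_sum]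
      refine Finset.sum_congr rfl fun i _ => ?_
      ring
  rw [h]
  refine Matrix.PosSemidef.smul (Matrix.posSemidef_sum _ fun i _ =>
    posSemidef_sum_inv_mul_sub _ fun q => by exact_mod_cast P.size_pos q) ?_
  -- For n = 1 the factor (n - 1)⁻¹ is 0 by convention, still nonnegative.
  have := P.one_le_n
  exact mul_nonneg (mul_self_nonneg r) (inv_nonneg.2 (by linarith))

end FactorialPopulation

lemma card_factorialEffect (K : ℕ) : Fintype.card (FactorialEffect K) = 2 ^ K - 1 := by
  have h := Fintype.card_subtype_compl fun S : Finset (Fin K) => S = ∅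
  simp only [← ne_eq, ← Finset.nonempty_iff_ne_empty, Fintype.card_finset, Fintype.card_fin,
    Fintype.card_unique] at h
  exact h

lemma posSemidef_of_tendsto {ι : Type*} [Fintype ι] {u : ℕ → Matrix ι ι ℝ} {W : Matrix ι ι ℝ}
    (hu : ∀ j, (u j).PosSemidef) (h : Tendsto u atTop (𝓝 W)) : W.PosSemidef := by
  refine Matrix.PosSemidef.of_dotProduct_mulVec_nonneg ?_ fun c => ?_
  · exact tendsto_nhds_unique (((continuous_id.matrix_conjTranspose).tendsto W).comp h)
      (h.congr fun j => (hu j).isHermitian.symm)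
  · have hc : Continuous fun M : Matrix ι ι ℝ => star c ⬝ᵥ (M *ᵥ c) := by fun_prop
    exact ge_of_tendsto' ((hc.tendsto W).comp h) fun j => (hu j).dotProduct_mulVec_nonneg c

/-- The rank bound comes from the size of the matrix alone: rank ≤ F ≤ LF. -/
lemma rootsMeaningful_of_posSemidef (hL : 1 ≤ L)
    {V V' : Matrix (FactorialEffect K) (FactorialEffect K) ℝ} (hV : V.PosSemidef)
    (hV' : V'.PosSemidef) : RootsMeaningful V V' (L * (2 ^ K - 1)) := by
  refine ⟨hV, hV', (Matrix.rank_le_card_width V').trans ?_⟩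
  rw [card_factorialEffect]
  exact Nat.le_mul_of_pos_left _ hL

end SamplingCovariance

theorem mainTheorem11 (K L : ℕ) (hK : 1 ≤ K) (hL : 1 ≤ L) (a : ℝ) (ha : 0 < a) :
    -- the standard Gaussian vector of dimension `F = 2 ^ K - 1`
    IsCentralConvexUnimodal (stdGaussian (EuclideanSpace ℝ (FactorialEffect K))) ∧
    -- the truncated Gaussian vector of dimension `L F`
    IsCentralConvexUnimodal (truncGaussian (FactorialEffect K × Fin L) a) ∧
    -- the approximating law for a finite population
    (∀ P : FactorialPopulation K L, IsUnit P.Sxx.det →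
      RootsMeaningful P.Vperp P.Vpar (L * (2 ^ K - 1)) ∧
      ∀ (B : Matrix (FactorialEffect K) (FactorialEffect K) ℝ)
        (A : Matrix (FactorialEffect K) (FactorialEffect K × Fin L) ℝ),
        IsPosSemidefRoot B P.Vperp → IsRectRoot A P.Vpar →
        IsCentralConvexUnimodal (gaussianPlusTruncLaw B A a)) ∧
    -- the limiting law, after scaling by the square root of the population size, along a sequence
    -- of finite populations
    (∀ (P : ℕ → FactorialPopulation K L)
      (Wperp Wpar : Matrix (FactorialEffect K) (FactorialEffect K) ℝ),
      (∀ j, IsUnit (P j).Sxx.det) →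
      Tendsto (fun j => ((P j).n : ℝ) • (P j).Vperp) atTop (𝓝 Wperp) →
      Tendsto (fun j => ((P j).n : ℝ) • (P j).Vpar) atTop (𝓝 Wpar) →
      RootsMeaningful Wperp Wpar (L * (2 ^ K - 1)) ∧
      ∀ (B : Matrix (FactorialEffect K) (FactorialEffect K) ℝ)
        (A : Matrix (FactorialEffect K) (FactorialEffect K × Fin L) ℝ),
        IsPosSemidefRoot B Wperp → IsRectRoot A Wpar →
        IsCentralConvexUnimodal (gaussianPlusTruncLaw B A a)) := by
  refine ⟨isCentralConvexUnimodal_stdGaussian, isCentralConvexUnimodal_truncGaussian ha,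
    fun P _ => ⟨rootsMeaningful_of_posSemidef hL (P.samplingCov_posSemidef _)
      (P.samplingCov_posSemidef _), fun B A hB _ =>
        isCentralConvexUnimodal_gaussianPlusTruncLaw hB.1 A ha⟩,
    fun P Wperp Wpar _ hperp hpar => ⟨rootsMeaningful_of_posSemidef hL
      (posSemidef_of_tendsto (fun j => ?_) hperp) (posSemidef_of_tendsto (fun j => ?_) hpar),
      fun B A hB _ => isCentralConvexUnimodal_gaussianPlusTruncLaw hB.1 A ha⟩⟩
  · exact ((P j).samplingCov_posSemidef _).smul (Nat.cast_nonneg _)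
  · exact ((P j).samplingCov_posSemidef _).smul (Nat.cast_nonneg _)
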